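/- Let $\Gamma$ be an uncountable set. For a natural number $n\ge 1$ let $\sigma_n(\Gamma)=\{x\in\{0,1\}^\Gamma : |\{\gamma\in\Gamma : x_\gamma\neq 0\}|\le n\}$, with the topology of a subspace of the product $\{0,1\}^\Gamma$ of discrete two-point spaces. Let $T$ be the set of all sequences $\tau=(\tau_n)_{n=1}^\infty$ with $\tau_n\in\{0,1,2,\dots\}\cup\{\omega\}$. For $\tau\in T$ let $\sigma_\tau(\Gamma)=\prod_{n=1}^\infty\sigma_n(\Gamma)^{\tau_n}$ with the product topology, where the exponent $\omega$ means a countably infinite power and the exponent $0$ means that the factor is absent. Let $j(\tau)\in\{0,1,2,\dots\}\cup\{\omega\}$ be the supremum of all $n\ge1$ with $\tau_n>0$, and $i(\tau)\in\{0,1,2,\dots\}\cup\{\omega\}$ the supremum of all $n\ge1$ with $\tau_n=\omega$ (the supremum of the empty set being $0$). Let $\tau,\tau'\in T$. (1) If $j(\tau)<\omega$, then $\sigma_{\tau'}(\Gamma)$ is homeomorphic to $\sigma_\tau(\Gamma)$ if and only if $i(\tau)=i(\tau')$ and $\tau_n=\tau'_n$ for all $n>i(\tau)$. (2) If $i(\tau)=\omega$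 and $i(\tau')=\omega$, then $\sigma_\tau(\Gamma)$ is homeomorphic to $\sigma_{\tau'}(\Gamma)$. -/

import Mathlib

/-- The space `σ_n(Γ)` of all points of the Cantor cube `{0,1}^Γ` whose support has at most `n`
elements, with the topology of a subspace of the product of discrete two-point spaces. -/
abbrev SigmaSpace (n : ℕ) (Γ : Type*) : Type _ :=
  {x : Γ → Bool // {γ : Γ | x γ = true}.encard ≤ (n : ℕ∞)}

/-- The product `σ_τ(Γ) = ∏_{n ≥ 1} σ_n(Γ)^{τ_n}` with the product topology. The power with exponent
`τ_n ∈ {0, 1, 2, …, ω}` is taken over the index set of all natural numbers less than `τ_n`. -/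
abbrev SigmaProd (τ : ℕ+ → ℕ∞) (Γ : Type*) : Type _ :=
  ∀ n : ℕ+, {k : ℕ // (k : ℕ∞) < τ n} → SigmaSpace (n : ℕ) Γ

/-- `j(τ)`: the supremum of all `n` with `τ_n > 0` (it is `0` if there are none). -/
noncomputable def supJ (τ : ℕ+ → ℕ∞) : ℕ∞ :=
  ⨆ (n : ℕ+) (_ : 0 < τ n), ((n : ℕ) : ℕ∞)

/-- `i(τ)`: the supremum of all `n` with `τ_n = ω` (it is `0` if there are none). -/
noncomputable def supI (τ : ℕ+ → ℕ∞) : ℕ∞ :=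
  ⨆ (n : ℕ+) (_ : τ n = ⊤), ((n : ℕ) : ℕ∞)

/-!
The topological type of `σ_τ(Γ)` is controlled by the numbers `c_n = ∑_{m ≥ n} τ_m` (`factorCount`).

*Homeomorphic products.* Fixing one point of the infinite set `Γ` splits `σ_n(Γ)` into clopen copies
of `σ_n(Γ)` and `σ_{n-1}(Γ)`; hence `σ_n(Γ) ≅ σ_n(Γ) ⊕ σ_k(Γ)` for `k < n`. If `X ≅ X ⊕ Y` and
`Y ≅ Y ⊕ 1`, then `X^ω` and `X^ω × Y` are both homeomorphic to `X^ω ⊕ X^ω × Y`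
(`nonempty_pow_prod_homeomorph_of_sum`), so `σ_n(Γ)^ω` absorbs `σ_k(Γ)` for `1 ≤ k ≤ n`. Absorption
passes to countable products (`nonempty_prod_pi_homeomorph`), so the exponents `τ_k` with
`k ≤ i(τ)` are irrelevant. As `k ≤ i(τ)` means that some `m ≥ k` has `τ_m = ω`, this also covers
`i(τ) = ω`.

*The invariant.* In `σ_m(Γ)` the singletons `{γ}` have neighbourhoods no `m + 1` of which meet,
whereas for any choice of neighbourhoods every uncountable set of indices contains `m` whose
neighbourhoods do meet. The property `HasIntersectionFamilies Γ K n k` asks for `k` such families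
with numbers at least `n`, which in addition meet simultaneously. It is visibly a topological property, and it holds
for `σ_τ(Γ)` if and only if `k ≤ c_n`. For one direction, use the singletons in `k` different
coordinates, and the existence of free choices for finite-valued set mappings on uncountable sets
(`Set.exists_injective_free`). For the other, the `Δ`-system lemma makes the supports of the
points of each family uniform. Then the number of neighbourhoods that can meet is computed from
the room that root and petals leave in each coordinate: some coordinate is too small for
`m s + 1` petals of the family `s`, and two families never share that coordinate, because it
would have to accommodate the petals of both
(`HasIntersectionFamilies.exists_injective`).

So homeomorphic products have equal counts `c_n`. If `j(τ) < ω`, then `c_n = ω` exactly for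
`n ≤ i(τ)`, and `τ_n` is recovered from `c_n = τ_n + c_{n+1}` for `n > i(τ)`.
-/

/-! ### Rearranging products of spaces -/

section Rearrangement

variable {ι : Type*}

/-- A `κ`-th power of a product is the product of the `κ`-th powers. -/
def Homeomorph.piFunSwap (κ : Type*) (X : ι → Type*) [∀ i, TopologicalSpace (X i)] :
    (∀ i, κ → X i) ≃ₜ (κ → ∀ i, X i) where
  toFun f k i := f i k
  invFun f i k := f k i
  left_inv _ := rfl
  right_inv _ := rfl
  continuous_toFun := by fun_prop
  continuous_invFun := by fun_prop

/-- A product of binary products is the binary product of the products. -/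
def Homeomorph.piProd (X Y : ι → Type*) [∀ i, TopologicalSpace (X i)]
    [∀ i, TopologicalSpace (Y i)] : (∀ i, X i × Y i) ≃ₜ (∀ i, X i) × (∀ i, Y i) where
  toFun f := (fun i => (f i).1, fun i => (f i).2)
  invFun f i := (f.1 i, f.2 i)
  left_inv _ := rfl
  right_inv _ := rfl
  continuous_toFun := by fun_prop
  continuous_invFun := by fun_prop

/-- A product of powers is a single product over the disjoint union of the exponents. -/
def Homeomorph.piSigma (E : ι → Type*) (X : ι → Type*) [∀ i, TopologicalSpace (X i)] :
    (∀ i, E i → X i) ≃ₜ (∀ p : Σ i, E i, X p.1) where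
  toFun f p := f p.1 p.2
  invFun f i e := f ⟨i, e⟩
  left_inv _ := rfl
  right_inv _ := rfl
  continuous_toFun := by fun_prop
  continuous_invFun := by fun_prop

end Rearrangement

/-! ### Absorption of factors in infinite products -/

section Absorption

/-- A countable power absorbs one more copy of its base. -/
theorem nonempty_prod_pow_homeomorph (X : Type*) [TopologicalSpace X] :
    Nonempty ((ℕ → X) × X ≃ₜ (ℕ → X)) := by
  obtain ⟨e⟩ : Nonempty (ℕ ⊕ Unit ≃ ℕ) := nonempty_equiv_of_countable
  exact ⟨((Homeomorph.refl _).prodCongr (Homeomorph.funUnique Unit X).symm).trans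
    (Homeomorph.sumArrowHomeomorphProdArrow.symm.trans
      (Homeomorph.piCongrLeft (Y := fun _ : ℕ => X) e))⟩

/-- If `X` contains a clopen copy of `Y` that can be removed without changing `X`, and `Y` has an
isolated point that can be removed without changing `Y`, then `X^ω` absorbs `Y`. With `Z = X^ω`
and `W = Z × Y`, distributing one coordinate of `Z` gives `Z ≅ Z ⊕ W`, distributing `Y` gives
`W ≅ W ⊕ Z`, and the two right-hand sides agree. -/
theorem nonempty_pow_prod_homeomorph_of_sum {X Y : Type*} [TopologicalSpace X]
    [TopologicalSpace Y] (hXY : X ≃ₜ X ⊕ Y) (hY : Y ≃ₜ Y ⊕ Unit) :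
    Nonempty ((ℕ → X) × Y ≃ₜ (ℕ → X)) := by
  obtain ⟨e⟩ := nonempty_prod_pow_homeomorph X
  have hZ : (ℕ → X) ≃ₜ (ℕ → X) ⊕ ((ℕ → X) × Y) :=
    e.symm.trans (((Homeomorph.refl _).prodCongr hXY).trans
      (Homeomorph.prodSumDistrib.trans (e.sumCongr (Homeomorph.refl _))))
  have hW : ((ℕ → X) × Y) ≃ₜ ((ℕ → X) × Y) ⊕ (ℕ → X) :=
    ((Homeomorph.refl _).prodCongr hY).trans (Homeomorph.prodSumDistrib.trans
      ((Homeomorph.refl _).sumCongr (Homeomorph.prodUnique _ _)))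
  exact ⟨hW.trans ((Homeomorph.sumComm _ _).trans hZ.symm)⟩

/-- A space that is homeomorphic to its own countable power and absorbs each of countably many
spaces absorbs their product. -/
theorem nonempty_prod_pi_homeomorph {κ : Type*} [Countable κ] {W : Type*} [TopologicalSpace W]
    {Y : κ → Type*} [∀ i, TopologicalSpace (Y i)] (hW : W ≃ₜ (ℕ → W))
    (hY : ∀ i, Nonempty (W × Y i ≃ₜ W)) : Nonempty (W × (∀ i, Y i) ≃ₜ W) := by
  obtain ⟨e⟩ : Nonempty (ℕ ⊕ κ × ℕ ≃ ℕ) := nonempty_equiv_of_countable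
  have h : W × (κ → W) ≃ₜ W :=
    (hW.prodCongr ((Homeomorph.piCongrRight fun _ => hW).trans Homeomorph.piCurry.symm)).trans
      (Homeomorph.sumArrowHomeomorphProdArrow.symm.trans
        ((Homeomorph.piCongrLeft (Y := fun _ : ℕ => W) e).trans hW.symm))
  exact ⟨(h.symm.prodCongr (Homeomorph.refl _)).trans ((Homeomorph.prodAssoc _ _ _).trans
    (((Homeomorph.refl _).prodCongr ((Homeomorph.piProd _ _).symm.trans
      (Homeomorph.piCongrRight fun i => (hY i).some))).trans h))⟩

/-- A countable product of powers depends only on the factors with exponent `ω` as soon as the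
countable powers of these absorb every factor. -/
theorem nonempty_pi_pow_homeomorph {ι : Type*} [Countable ι] {X : ι → Type*}
    [∀ i, TopologicalSpace (X i)] (S : Set ι) (E : ι → Type*) [∀ i, Countable (E i)]
    (hE : ∀ i ∈ S, Nonempty (E i ≃ ℕ))
    (hdom : ∀ i, ∃ m ∈ S, Nonempty ((ℕ → X m) × X i ≃ₜ (ℕ → X m))) :
    Nonempty ((∀ i, E i → X i) ≃ₜ (∀ m : S, ℕ → X m)) := by
  classical
  have hW : (∀ m : S, ℕ → X m) ≃ₜ (ℕ → ∀ m : S, ℕ → X m) :=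
    (Homeomorph.piCongrRight fun m : S =>
      (Homeomorph.piCongrLeft (Y := fun _ : ℕ × ℕ => X m) Nat.pairEquiv.symm).trans
        Homeomorph.piCurry).trans
      (Homeomorph.piFunSwap ℕ _)
  have habs : ∀ i, Nonempty ((∀ m : S, ℕ → X m) × X i ≃ₜ (∀ m : S, ℕ → X m)) := by
    intro i
    obtain ⟨m, hm, ⟨e⟩⟩ := hdom i
    have s := Homeomorph.piSplitAt (⟨m, hm⟩ : S) (fun m : S => ℕ → X m)
    exact ⟨(s.prodCongr (Homeomorph.refl _)).trans (((Homeomorph.prodComm _ _).prodCongr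
      (Homeomorph.refl _)).trans ((Homeomorph.prodAssoc _ _ _).trans
      (((Homeomorph.refl _).prodCongr e).trans ((Homeomorph.prodComm _ _).trans s.symm))))⟩
  obtain ⟨e⟩ := nonempty_prod_pi_homeomorph
    (Y := fun p : Σ i : {i // i ∉ S}, E i => X p.1) hW fun p => habs p.1
  have hS : (∀ i : {i // i ∈ S}, E i → X i) ≃ₜ (∀ m : S, ℕ → X m) :=
    Homeomorph.piCongrRight fun i =>
      Homeomorph.piCongrLeft (Y := fun _ : ℕ => X i) (hE i i.2).some
  exact ⟨(Homeomorph.piEquivPiSubtypeProd (fun i => i ∈ S) _).trans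
    ((hS.prodCongr (Homeomorph.piSigma _ _)).trans e)⟩

end Absorption

/-! ### Splitting off clopen pieces of `σ_n(Γ)` -/

section Splitting

variable {Γ : Type*}

instance SigmaSpace.compactSpace (n : ℕ) (Γ : Type*) : CompactSpace (SigmaSpace n Γ) := by
  have h : {x : Γ → Bool | {γ : Γ | x γ = true}.encard ≤ (n : ℕ∞)} =
      ⋂ (F : Finset Γ) (_ : F.card = n + 1), ⋃ a ∈ F, {x : Γ → Bool | x a = false} := by
    ext x
    simp only [Set.mem_ofPred_eq, Set.mem_iInter, Set.mem_iUnion, exists_prop]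
    constructor
    · intro hx F hF
      by_contra! hcon
      have h1 : (F : Set Γ) ⊆ {γ | x γ = true} := fun a ha => by simpa using hcon a ha
      have h2 := (Set.encard_le_encard h1).trans hx
      rw [Set.encard_coe_eq_coe_finsetCard, hF] at h2
      norm_cast at h2
      omega
    · intro hx
      by_contra! hcon
      obtain ⟨t, ht, htc⟩ := Set.exists_subset_encard_eq
        (k := ((n + 1 : ℕ) : ℕ∞)) (by push_cast; exact Order.add_one_le_of_lt hcon)
      have htf : t.Finite := Set.finite_of_encard_eq_coe htc
      obtain ⟨a, ha, hxa⟩ := hx htf.toFinset (by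
        rw [htf.encard_eq_coe_toFinset_card] at htc; exact_mod_cast htc)
      have := ht (htf.mem_toFinset.1 ha)
      simp [hxa] at this
  have hc : IsClosed {x : Γ → Bool | {γ : Γ | x γ = true}.encard ≤ (n : ℕ∞)} := by
    rw [h]
    refine isClosed_iInter fun F => isClosed_iInter fun _ => F.finite_toSet.isClosed_biUnion ?_
    exact fun a _ => isClosed_eq (continuous_apply a) continuous_const
  exact isCompact_iff_compactSpace.1 hc.isCompact

/-- Renaming the points of `Γ`. -/
def SigmaSpace.congr (n : ℕ) {Γ Δ : Type*} (e : Γ ≃ Δ) : SigmaSpace n Γ ≃ₜ SigmaSpace n Δ :=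
  (Homeomorph.piCongrLeft (Y := fun _ : Δ => Bool) e).subtype fun x => by
    have h : {γ : Γ | x γ = true} =
        e ⁻¹' {δ : Δ | Homeomorph.piCongrLeft (Y := fun _ : Δ => Bool) e x δ = true} := by
      ext γ
      simp [Homeomorph.piCongrLeft_apply_apply]
    rw [h, Set.encard_preimage_of_bijective e.bijective]

theorem Option.setOf_elim_true {Γ : Type*} (b : Bool) (x : Γ → Bool) :
    {o : Option Γ | (o.elim b x) = true}.encard =
      {γ | x γ = true}.encard + (if b = true then 1 else 0) := by
  have h : {o : Option Γ | (o.elim b x) = true} =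
      some '' {γ | x γ = true} ∪ {o | o = none ∧ b = true} := by
    ext o
    cases o <;> simp
  rw [h, Set.encard_union_eq, (Option.some_injective Γ).encard_image]
  · cases b <;> simp
  · rw [Set.disjoint_left]
    rintro _ ⟨γ, -, rfl⟩
    simp

/-- Points of `σ_{n+1}(Γ ∪ {∞})` not containing `∞` form a clopen copy of `σ_{n+1}(Γ)`, the others
a clopen copy of `σ_n(Γ)`. -/
noncomputable def SigmaSpace.sumOption (n : ℕ) (Γ : Type*) :
    SigmaSpace (n + 1) Γ ⊕ SigmaSpace n Γ ≃ₜ SigmaSpace (n + 1) (Option Γ) := by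
  refine Continuous.homeoOfEquivCompactToT2 (f := Equiv.ofBijective (Sum.elim
    (fun x => ⟨fun o => o.elim false x.1, ?_⟩) (fun x => ⟨fun o => o.elim true x.1, ?_⟩)) ⟨?_, ?_⟩) ?_
  · rw [Option.setOf_elim_true]
    simpa using x.2
  · rw [Option.setOf_elim_true]
    simpa using x.2
  · rintro (⟨x, hx⟩ | ⟨x, hx⟩) (⟨y, hy⟩ | ⟨y, hy⟩) h <;>
      simp only [Sum.elim_inl, Sum.elim_inr, Subtype.mk.injEq] at h
    · have : x = y := funext fun γ => congrFun h (some γ)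
      simp [this]
    · simpa using congrFun h none
    · simpa using congrFun h none
    · have : x = y := funext fun γ => congrFun h (some γ)
      simp [this]
  · rintro ⟨x, hx⟩
    have hxe : (fun o : Option Γ => o.elim (x none) fun γ => x (some γ)) = x := by
      ext o
      cases o <;> rfl
    rw [← hxe, Option.setOf_elim_true] at hx
    cases hb : x none
    · refine ⟨Sum.inl ⟨fun γ => x (some γ), by simpa [hb] using hx⟩, Subtype.ext ?_⟩
      simpa [hb] using hxe
    · refine ⟨Sum.inr ⟨fun γ => x (some γ), by simpa [hb] using hx⟩, Subtype.ext ?_⟩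
      simpa [hb] using hxe
  · simp only [continuous_sum_dom]
    constructor <;>
    · refine Continuous.subtype_mk (continuous_pi fun o => ?_) _
      cases o
      · exact continuous_const
      · exact (continuous_apply _).comp continuous_subtype_val

variable [Infinite Γ]

theorem SigmaSpace.nonempty_homeomorph_sum_pred (n : ℕ) :
    Nonempty (SigmaSpace (n + 1) Γ ≃ₜ SigmaSpace (n + 1) Γ ⊕ SigmaSpace n Γ) := by
  obtain ⟨e⟩ : Nonempty (Γ ≃ Option Γ) := by
    rw [← Cardinal.eq, Cardinal.mk_option]
    exact (Cardinal.add_one_eq (Cardinal.aleph0_le_mk Γ)).symm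
  exact ⟨(SigmaSpace.congr _ e).trans (SigmaSpace.sumOption n Γ).symm⟩

theorem SigmaSpace.nonempty_homeomorph_sum {k n : ℕ} (h : k < n) :
    Nonempty (SigmaSpace n Γ ≃ₜ SigmaSpace n Γ ⊕ SigmaSpace k Γ) := by
  induction n, h using Nat.le_induction with
  | base => exact SigmaSpace.nonempty_homeomorph_sum_pred k
  | succ n _ ih =>
    obtain ⟨e⟩ := ih
    obtain ⟨f⟩ := SigmaSpace.nonempty_homeomorph_sum_pred (Γ := Γ) n
    exact ⟨f.trans (((Homeomorph.refl _).sumCongr e).trans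
      ((Homeomorph.sumAssoc _ _ _).symm.trans (f.symm.sumCongr (Homeomorph.refl _))))⟩

theorem SigmaSpace.nonempty_homeomorph_sum_unit {n : ℕ} (h : 0 < n) :
    Nonempty (SigmaSpace n Γ ≃ₜ SigmaSpace n Γ ⊕ Unit) := by
  obtain ⟨e⟩ := SigmaSpace.nonempty_homeomorph_sum (Γ := Γ) h
  have : Unique (SigmaSpace 0 Γ) :=
    { default := ⟨fun _ => false, by simp⟩
      uniq := fun x => by
        obtain ⟨x, hx⟩ := x
        simp only [Nat.cast_zero, nonpos_iff_eq_zero, Set.encard_eq_zero] at hx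
        refine Subtype.ext (funext fun γ => ?_)
        have : γ ∉ {γ : Γ | x γ = true} := by simp [hx]
        simpa using this }
  exact ⟨e.trans ((Homeomorph.refl _).sumCongr (Homeomorph.homeomorphOfUnique _ _))⟩

theorem SigmaSpace.nonempty_pow_prod_homeomorph {k n : ℕ} (hk : 0 < k) (h : k ≤ n) :
    Nonempty ((ℕ → SigmaSpace n Γ) × SigmaSpace k Γ ≃ₜ (ℕ → SigmaSpace n Γ)) := by
  rcases h.eq_or_lt with rfl | h
  · exact nonempty_prod_pow_homeomorph _
  · obtain ⟨e⟩ := SigmaSpace.nonempty_homeomorph_sum (Γ := Γ) h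
    obtain ⟨f⟩ := SigmaSpace.nonempty_homeomorph_sum_unit (Γ := Γ) hk
    exact nonempty_pow_prod_homeomorph_of_sum e f

end Splitting

/-! ### Homeomorphic products -/

/-- If `τ_m = ω`, the exponents `τ_n` with `n ≤ m` are irrelevant for the topological type. -/
theorem SigmaProd.nonempty_homeomorph {Γ : Type*} [Infinite Γ] {τ τ' : ℕ+ → ℕ∞}
    (hD : ∀ n, (∃ m, n ≤ m ∧ τ m = ⊤) ↔ ∃ m, n ≤ m ∧ τ' m = ⊤)
    (heq : ∀ n, (¬ ∃ m, n ≤ m ∧ τ m = ⊤) → τ n = τ' n) :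
    Nonempty (SigmaProd τ Γ ≃ₜ SigmaProd τ' Γ) := by
  classical
  have key : ∀ ρ : ℕ+ → ℕ∞, (∀ n, (∃ m, n ≤ m ∧ τ m = ⊤) ↔ ∃ m, n ≤ m ∧ ρ m = ⊤) →
      Nonempty ((∀ n : {n : ℕ+ // ∃ m, n ≤ m ∧ τ m = ⊤}, {k : ℕ // (k : ℕ∞) < ρ n} →
        SigmaSpace (n : ℕ+) Γ) ≃ₜ
      (∀ n : {n : ℕ+ // ∃ m, n ≤ m ∧ τ m = ⊤}, ℕ → SigmaSpace (n : ℕ+) Γ)) := by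
    intro ρ hρ
    let S : Set {n : ℕ+ // ∃ m, n ≤ m ∧ τ m = ⊤} := {n | ρ n = ⊤}
    have hdom : ∀ n : {n : ℕ+ // ∃ m, n ≤ m ∧ τ m = ⊤}, ∃ m ∈ S,
        Nonempty ((ℕ → SigmaSpace (m : ℕ+) Γ) × SigmaSpace (n : ℕ+) Γ ≃ₜ
          (ℕ → SigmaSpace (m : ℕ+) Γ)) := by
      rintro ⟨n, hn⟩
      obtain ⟨m, hnm, hm⟩ := (hρ n).1 hn
      exact ⟨⟨m, (hρ m).2 ⟨m, le_rfl, hm⟩⟩, hm,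
        SigmaSpace.nonempty_pow_prod_homeomorph n.pos hnm⟩
    obtain ⟨e⟩ := nonempty_pi_pow_homeomorph S (fun n => {k : ℕ // (k : ℕ∞) < ρ n})
      (fun n hn => ⟨Equiv.subtypeUnivEquiv fun k => by
        rw [show ρ n = ⊤ from hn]; exact ENat.natCast_lt_top k⟩) hdom
    obtain ⟨f⟩ := nonempty_pi_pow_homeomorph S (fun _ => ℕ) (fun _ _ => ⟨Equiv.refl ℕ⟩) hdom
    exact ⟨e.trans f.symm⟩
  obtain ⟨e⟩ := key τ fun _ => Iff.rfl
  obtain ⟨e'⟩ := key τ' hD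
  have f : (∀ n : {n : ℕ+ // ¬ ∃ m, n ≤ m ∧ τ m = ⊤}, {k : ℕ // (k : ℕ∞) < τ n} →
        SigmaSpace (n : ℕ+) Γ) ≃ₜ (∀ n : {n : ℕ+ // ¬ ∃ m, n ≤ m ∧ τ m = ⊤},
          {k : ℕ // (k : ℕ∞) < τ' n} → SigmaSpace (n : ℕ+) Γ) :=
    Homeomorph.piCongrRight fun n => Homeomorph.piCongrLeft
      (Y := fun _ : {k : ℕ // (k : ℕ∞) < τ' n} => SigmaSpace (n : ℕ+) Γ)
      (Equiv.subtypeEquivRight fun k => by rw [heq n n.2])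
  exact ⟨(Homeomorph.piEquivPiSubtypeProd _ _).trans (((e.trans e'.symm).prodCongr f).trans
    (Homeomorph.piEquivPiSubtypeProd (fun n => ∃ m, n ≤ m ∧ τ m = ⊤)
      (fun n => {k : ℕ // (k : ℕ∞) < τ' n} → SigmaSpace (n : ℕ) Γ)).symm)⟩

/-! ### Uncountable families of finite sets -/

section Combinatorics

variable {α β κ : Type*}

/-- The pigeonhole principle for an uncountable set coloured by countably many colours. -/
theorem Set.exists_not_countable_fiber [Countable β] {S : Set α} (hS : ¬ S.Countable)
    (f : α → β) : ∃ b, ¬ {a ∈ S | f a = b}.Countable := by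
  by_contra! h
  refine hS ((Set.countable_iUnion h).mono fun a ha => ?_)
  exact Set.mem_iUnion.2 ⟨f a, ha, rfl⟩

/-- The `Δ`-system lemma for sets of the same finite size. -/
theorem Set.exists_deltaSystem_of_card [DecidableEq β] (n : ℕ) (f : α → Finset β) {S : Set α}
    (hS : ¬ S.Countable) (hf : ∀ a ∈ S, (f a).card = n) :
    ∃ S' ⊆ S, ¬ S'.Countable ∧ ∃ R, ∀ a ∈ S', ∀ b ∈ S', a ≠ b → f a ∩ f b = R := by
  induction n generalizing f S with
  | zero =>
    refine ⟨S, Subset.rfl, hS, ∅, fun a ha b _ _ => ?_⟩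
    rw [Finset.card_eq_zero.1 (hf a ha), Finset.empty_inter]
  | succ n ih =>
    by_cases hx : ∃ x, ¬ {a ∈ S | x ∈ f a}.Countable
    · obtain ⟨x, hx⟩ := hx
      obtain ⟨S', hS', hunc, R, hR⟩ := ih (fun a => (f a).erase x) hx fun a ha => by
        rw [Finset.card_erase_of_mem ha.2, hf a ha.1, Nat.add_sub_cancel]
      refine ⟨S', fun a ha => (hS' ha).1, hunc, insert x R, fun a ha b hb hab => ?_⟩
      rw [← hR a ha b hb hab]
      have hxa := (hS' ha).2
      have hxb := (hS' hb).2
      ext y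
      by_cases hy : y = x <;> simp [hy, hxa, hxb]
    · -- Every point lies in countably many members, so a maximal disjoint subfamily is uncountable.
      push Not at hx
      obtain ⟨M, hM⟩ := zorn_subset {M : Set α | M ⊆ S ∧ M.PairwiseDisjoint f} (by
        intro c hc hchain
        refine ⟨⋃₀ c, ⟨sUnion_subset fun s hs => (hc hs).1, ?_⟩, fun s hs => subset_sUnion_of_mem hs⟩
        rw [pairwiseDisjoint_sUnion hchain.directedOn]
        exact fun s hs => (hc hs).2)
      refine ⟨M, hM.prop.1, fun hMc => hS ?_, ∅, fun a ha b hb hab =>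
        Finset.disjoint_iff_inter_eq_empty.1 (hM.prop.2 ha hb hab)⟩
      refine (hMc.union ((hMc.biUnion fun a _ => (f a).countable_toSet).biUnion
        fun x _ => hx x)).mono fun a ha => ?_
      by_contra hcon
      rw [mem_union, not_or] at hcon
      refine hcon.1 (hM.le_of_ge (y := insert a M) ⟨insert_subset ha hM.prop.1, ?_⟩
        (subset_insert a M) (mem_insert a M))
      refine hM.prop.2.insert fun b hb _ => Finset.disjoint_left.2 fun x hxa hxb => hcon.2 ?_
      exact mem_biUnion (mem_biUnion hb hxb) ⟨ha, hxa⟩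

/-- The `Δ`-system lemma for uncountable families of finite sets. -/
theorem Set.exists_deltaSystem [DecidableEq β] (f : α → Finset β) {S : Set α}
    (hS : ¬ S.Countable) :
    ∃ S' ⊆ S, ¬ S'.Countable ∧ ∃ R, ∀ a ∈ S', ∀ b ∈ S', a ≠ b → f a ∩ f b = R := by
  obtain ⟨n, hn⟩ := exists_not_countable_fiber hS fun a => (f a).card
  obtain ⟨S', hS', h⟩ := exists_deltaSystem_of_card n f hn fun a ha => ha.2
  exact ⟨S', fun a ha => (hS' ha).1, h⟩

/-- Finitely many set mappings with finite values have a common free choice of distinct points in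
any uncountable set. The first point is chosen last, from a countably infinite set whose values
all the other points avoid. -/
theorem Set.exists_injective_free [Finite κ] {S : Set α} (hS : ¬ S.Countable)
    (A : κ → α → Finset α) :
    ∃ g : κ → α, Function.Injective g ∧ (∀ a, g a ∈ S) ∧
      ∀ a b, a ≠ b → g a ∉ A b (g b) := by
  classical
  have := Fintype.ofFinite κ
  have key : ∀ T : Finset κ, ∀ S : Set α, ¬ S.Countable → ∃ g : κ → α, (∀ a ∈ T, g a ∈ S) ∧
      ∀ a ∈ T, ∀ b ∈ T, a ≠ b → g a ≠ g b ∧ g a ∉ A b (g b) := by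
    intro T
    induction T using Finset.induction_on with
    | empty =>
      intro S hS
      obtain ⟨x, -⟩ : S.Nonempty := nonempty_iff_ne_empty.2 fun h => hS (by simp [h])
      exact ⟨fun _ => x, by simp, by simp⟩
    | insert a T ha ih =>
      intro S hS
      have hinf : S.Infinite := fun h => hS h.countable
      obtain ⟨E, hES, hEinf, hEc⟩ : ∃ E ⊆ S, E.Infinite ∧ E.Countable := by
        let ν := hinf.natEmbedding
        refine ⟨range fun n => (ν n : α), ?_, infinite_range_of_injective ?_, countable_range _⟩
        · rintro _ ⟨n, rfl⟩
          exact (ν n).2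
        · exact Subtype.val_injective.comp ν.injective
      have hB : (E ∪ ⋃ e ∈ E, (A a e : Set α)).Countable :=
        hEc.union (hEc.biUnion fun e _ => (A a e).countable_toSet)
      obtain ⟨g, hgS, hg⟩ := ih (S \ (E ∪ ⋃ e ∈ E, (A a e : Set α)))
        fun h => hS ((h.union hB).mono (by simp))
      obtain ⟨e, heE, he⟩ := (hEinf.sdiff (T.biUnion fun b => A b (g b)).finite_toSet).nonempty
      have heA : ∀ b ∈ T, e ∉ A b (g b) := fun b hb h => he (by
        simp only [Finset.coe_biUnion, mem_iUnion]
        exact ⟨b, hb, h⟩)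
      have hgE : ∀ b ∈ T, g b ≠ e ∧ g b ∉ A a e := fun b hb =>
        ⟨fun h => (hgS b hb).2 (Or.inl (h ▸ heE)),
          fun h => (hgS b hb).2 (Or.inr (mem_biUnion heE h))⟩
      have hne : ∀ b ∈ T, b ≠ a := fun b hb h => ha (h ▸ hb)
      refine ⟨Function.update g a e, fun b hb => ?_, fun b hb c hc hbc => ?_⟩
      · rcases Finset.mem_insert.1 hb with rfl | hb
        · simpa using hES heE
        · simpa [hne b hb] using (hgS b hb).1
      · rcases Finset.mem_insert.1 hb with rfl | hbT <;>
          rcases Finset.mem_insert.1 hc with rfl | hcT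
        · exact absurd rfl hbc
        · simpa [hne c hcT] using ⟨(hgE c hcT).1.symm, heA c hcT⟩
        · simpa [hne b hbT] using hgE b hbT
        · simpa [hne b hbT, hne c hcT] using hg b hbT c hcT hbc
  obtain ⟨g, hgS, hg⟩ := key Finset.univ S hS
  refine ⟨g, fun a b hab => ?_, fun a => hgS a (Finset.mem_univ a), fun a b hab =>
    (hg a (Finset.mem_univ a) b (Finset.mem_univ b) hab).2⟩
  by_contra hne
  exact (hg a (Finset.mem_univ a) b (Finset.mem_univ b) hne).1 hab

end Combinatorics

/-! ### Points of products of the spaces `σ_n(Γ)` -/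

section Points

open Topology

variable {I Γ : Type*} {N : I → ℕ}

open scoped Classical in
/-- The number of elements of a finite set of pairs with prescribed first coordinate. -/
noncomputable def sliceCard (F : Finset (I × Γ)) (i : I) : ℕ := (F.filter fun q => q.1 = i).card

open scoped Classical in
theorem sliceCard_mono {F G : Finset (I × Γ)} (h : F ⊆ G) (i : I) :
    sliceCard F i ≤ sliceCard G i :=
  Finset.card_le_card (Finset.filter_subset_filter _ h)

open scoped Classical in
theorem sliceCard_union_of_disjoint {F G : Finset (I × Γ)} (h : Disjoint F G) (i : I) :
    sliceCard (F ∪ G) i = sliceCard F i + sliceCard G i := by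
  rw [sliceCard, Finset.filter_union, Finset.card_union_of_disjoint
    (Finset.disjoint_filter_filter h)]
  rfl

open scoped Classical in
theorem sliceCard_union_le (F G : Finset (I × Γ)) (i : I) :
    sliceCard (F ∪ G) i ≤ sliceCard F i + sliceCard G i := by
  rw [sliceCard, Finset.filter_union]
  exact Finset.card_union_le _ _

open scoped Classical in
theorem sliceCard_biUnion_le {κ : Type*} (T : Finset κ) (F : κ → Finset (I × Γ)) (i : I) :
    sliceCard (T.biUnion F) i ≤ ∑ a ∈ T, sliceCard (F a) i := by
  rw [sliceCard, Finset.filter_biUnion]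
  exact Finset.card_biUnion_le

open scoped Classical in
theorem sliceCard_biUnion {κ : Type*} (T : Finset κ) (F : κ → Finset (I × Γ))
    (h : (T : Set κ).PairwiseDisjoint F) (i : I) :
    sliceCard (T.biUnion F) i = ∑ a ∈ T, sliceCard (F a) i := by
  rw [sliceCard, Finset.filter_biUnion, Finset.card_biUnion]
  · rfl
  · exact fun a ha b hb hab => Finset.disjoint_filter_filter (h ha hb hab)

theorem sliceCard_eq_encard (F : Finset (I × Γ)) (i : I) :
    (sliceCard F i : ℕ∞) = {γ | (i, γ) ∈ F}.encard := by
  classical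
  have himg : (F.filter (fun q => q.1 = i) : Set (I × Γ)) = Prod.mk i '' {γ | (i, γ) ∈ F} := by
    ext ⟨j, γ⟩
    simp only [Finset.coe_filter, Set.mem_ofPred_eq, Set.mem_image, Prod.mk.injEq]
    constructor
    · rintro ⟨h, rfl⟩
      exact ⟨γ, h, rfl, rfl⟩
    · rintro ⟨_, h, rfl, rfl⟩
      exact ⟨h, rfl⟩
  rw [sliceCard, ← Set.encard_coe_eq_coe_finsetCard, himg,
    (Prod.mk_right_injective i).encard_image]

open scoped Classical in
/-- The point of `∏ σ_{N i}(Γ)` whose supports are the slices of a finite set of pairs. -/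
noncomputable def SigmaSpace.ofFinset (F : Finset (I × Γ)) (hF : ∀ i, sliceCard F i ≤ N i) :
    ∀ i, SigmaSpace (N i) Γ :=
  fun i => ⟨fun γ => decide ((i, γ) ∈ F), by
    simp only [decide_eq_true_eq]
    rw [← sliceCard_eq_encard]
    exact_mod_cast hF i⟩

theorem SigmaSpace.ofFinset_eq_true {F : Finset (I × Γ)} {hF : ∀ i, sliceCard F i ≤ N i}
    {q : I × Γ} : (SigmaSpace.ofFinset F hF q.1).1 q.2 = true ↔ q ∈ F := by
  simp [SigmaSpace.ofFinset]

theorem SigmaSpace.finite_setOf_mem (J : Finset I) (x : ∀ i, SigmaSpace (N i) Γ) :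
    {q : I × Γ | q.1 ∈ J ∧ (x q.1).1 q.2 = true}.Finite := by
  refine (J.finite_toSet.biUnion (t := fun i => Prod.mk i '' {γ | (x i).1 γ = true})
    fun i _ => (Set.finite_of_encard_le_coe (x i).2).image _).subset ?_
  rintro ⟨i, γ⟩ ⟨hi, hγ⟩
  exact Set.mem_biUnion hi ⟨γ, hγ, rfl⟩

/-- The supports of the coordinates of `x` with index in `J`, as one finite set of pairs. -/
noncomputable def SigmaSpace.support (J : Finset I) (x : ∀ i, SigmaSpace (N i) Γ) :
    Finset (I × Γ) := (SigmaSpace.finite_setOf_mem J x).toFinset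

theorem SigmaSpace.mem_support {J : Finset I} {x : ∀ i, SigmaSpace (N i) Γ} {q : I × Γ} :
    q ∈ SigmaSpace.support J x ↔ q.1 ∈ J ∧ (x q.1).1 q.2 = true := by
  simp [SigmaSpace.support]

theorem SigmaSpace.sliceCard_support_le (J : Finset I) (x : ∀ i, SigmaSpace (N i) Γ) (i : I) :
    sliceCard (SigmaSpace.support J x) i ≤ N i := by
  have h : (sliceCard (SigmaSpace.support J x) i : ℕ∞) ≤ N i := by
    rw [sliceCard_eq_encard]
    have hsub : {γ | (i, γ) ∈ SigmaSpace.support J x} ⊆ {γ | (x i).1 γ = true} :=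
      fun γ hγ => (SigmaSpace.mem_support.1 hγ).2
    exact (Set.encard_le_encard hsub).trans (x i).2
  exact_mod_cast h

theorem SigmaSpace.exists_finset_of_mem_nhds {x : ∀ i, SigmaSpace (N i) Γ}
    {V : Set (∀ i, SigmaSpace (N i) Γ)} (hV : V ∈ 𝓝 x) :
    ∃ A : Finset (I × Γ), ∀ y : ∀ i, SigmaSpace (N i) Γ,
      (∀ q ∈ A, (y q.1).1 q.2 = (x q.1).1 q.2) → y ∈ V := by
  have hind : IsInducing fun (y : ∀ i, SigmaSpace (N i) Γ) i => (y i).1 :=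
    IsInducing.piMap fun _ => IsInducing.subtypeVal
  have hind' := (Homeomorph.piCurry (X := I) (Y := Γ) (Z := Bool)).symm.isInducing.comp hind
  rw [hind'.nhds_eq_comap, Filter.mem_comap] at hV
  obtain ⟨W, hW, hWV⟩ := hV
  rw [nhds_pi, Filter.mem_pi'] at hW
  obtain ⟨A, t, ht, hA⟩ := hW
  refine ⟨A, fun y hy => hWV (hA fun q hq => ?_)⟩
  have hxq : (x q.1).1 q.2 ∈ t q := mem_of_mem_nhds (ht q)
  rw [← hy q hq] at hxq
  exact hxq

theorem SigmaSpace.setOf_eq_mem_nhds (A : Finset (I × Γ)) (x : ∀ i, SigmaSpace (N i) Γ) :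
    {y : ∀ i, SigmaSpace (N i) Γ | ∀ q ∈ A, (y q.1).1 q.2 = (x q.1).1 q.2} ∈ 𝓝 x := by
  refine (Filter.eventually_all_finset A).2 fun q _ => ?_
  have hc : Continuous fun y : ∀ i, SigmaSpace (N i) Γ => (y q.1).1 q.2 :=
    (continuous_apply q.2).comp (continuous_subtype_val.comp (continuous_apply q.1))
  exact hc.continuousAt.eventually_mem ((isOpen_discrete {(x q.1).1 q.2}).mem_nhds rfl)

end Points

/-! ### A topological invariant counting the factors of given size -/

section Invariant

open Topology

/-- A topological property that measures how many factors `σ_i(Γ)` with `i ≥ n` a product has.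
There are `k` families of points indexed by `Γ`, the `s`-th with an intersection number `m s ≥ n`:
for suitable neighbourhoods, no `m s + 1` members of the `s`-th family have a common point, while
for arbitrary neighbourhoods, and inside any uncountable set of indices, one can choose `m s`
members of each family so that all of the chosen neighbourhoods have a common point. -/
def HasIntersectionFamilies (Γ K : Type*) [TopologicalSpace K] (n k : ℕ) : Prop :=
  ∃ (m : Fin k → ℕ) (p : Fin k → Γ → K) (U : Fin k → Γ → Set K),
    (∀ s, n ≤ m s) ∧ (∀ s γ, U s γ ∈ 𝓝 (p s γ)) ∧
    (∀ s (g : Fin (m s + 1) → Γ), Function.Injective g → ¬ ∃ x, ∀ j, x ∈ U s (g j)) ∧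
    ∀ S : Set Γ, ¬ S.Countable → ∀ V : Fin k → Γ → Set K, (∀ s γ, V s γ ∈ 𝓝 (p s γ)) →
      ∃ g : (Σ s, Fin (m s)) → Γ, Function.Injective g ∧ (∀ a, g a ∈ S) ∧
        ∃ x, ∀ a, x ∈ V a.1 (g a)

theorem HasIntersectionFamilies.of_homeomorph {Γ K L : Type*} [TopologicalSpace K]
    [TopologicalSpace L] (e : K ≃ₜ L) {n k : ℕ} (h : HasIntersectionFamilies Γ K n k) :
    HasIntersectionFamilies Γ L n k := by
  obtain ⟨m, p, U, hm, hU, hsep, hmeet⟩ := h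
  refine ⟨m, fun s γ => e (p s γ), fun s γ => e.symm ⁻¹' U s γ, hm, fun s γ => ?_, ?_, ?_⟩
  · exact e.symm.continuous.continuousAt.preimage_mem_nhds (by simpa using hU s γ)
  · rintro s g hg ⟨x, hx⟩
    exact hsep s g hg ⟨e.symm x, hx⟩
  · intro S hS V hV
    obtain ⟨g, hg, hgS, x, hx⟩ := hmeet S hS (fun s γ => e ⁻¹' V s γ)
      fun s γ => e.continuous.continuousAt.preimage_mem_nhds (hV s γ)
    exact ⟨g, hg, hgS, e x, hx⟩

variable {I Γ : Type*} {N : I → ℕ} {n k : ℕ}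

/-- The families witnessing the property are those of singletons in `k` different coordinates. -/
theorem HasIntersectionFamilies.of_injective (hn : 0 < n) (c : Fin k → I)
    (hc : Function.Injective c) (hcn : ∀ s, n ≤ N (c s)) :
    HasIntersectionFamilies Γ (∀ i, SigmaSpace (N i) Γ) n k := by
  classical
  have hF : ∀ s (γ : Γ) i, sliceCard {(c s, γ)} i ≤ N i := by
    intro s γ i
    by_cases h : c s = i
    · refine (Finset.card_filter_le _ _).trans ?_
      have := hcn s
      rw [h] at this
      simp
      omega
    · simp [sliceCard, Finset.filter_singleton, h]
  refine ⟨fun s => N (c s), fun s γ => SigmaSpace.ofFinset {(c s, γ)} (hF s γ),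
    fun s γ => {y | (y (c s)).1 γ = true}, hcn, fun s γ => ?_, ?_, ?_⟩
  · filter_upwards [SigmaSpace.setOf_eq_mem_nhds {(c s, γ)}
      (SigmaSpace.ofFinset (N := N) {(c s, γ)} (hF s γ))] with y hy
    rw [hy (c s, γ) (by simp)]
    exact (SigmaSpace.ofFinset_eq_true (q := (c s, γ))).2 (by simp)
  · rintro s g hg ⟨x, hx⟩
    have h : Set.range g ⊆ {γ | (x (c s)).1 γ = true} := by
      rintro _ ⟨j, rfl⟩
      exact hx j
    have h' := (Set.encard_le_encard h).trans (x (c s)).2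
    rw [← Set.image_univ, hg.encard_image, Set.encard_univ, ENat.card_eq_coe_fintype_card,
      Fintype.card_fin] at h'
    norm_cast at h'
    exact Nat.not_succ_le_self _ h'
  · intro S hS V hV
    choose A hA using fun s γ => SigmaSpace.exists_finset_of_mem_nhds (hV s γ)
    obtain ⟨g, hg, hgS, hfree⟩ := Set.exists_injective_free
      (κ := Σ s, Fin (N (c s))) hS fun a γ => (A a.1 γ).image Prod.snd
    let F : Finset (I × Γ) := Finset.univ.image fun a => (c a.1, g a)
    have hFN : ∀ i, sliceCard F i ≤ N i := by
      intro i
      by_cases hi : ∃ s, c s = i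
      · obtain ⟨s, rfl⟩ := hi
        have hsub : (F.filter fun q => q.1 = c s) ⊆
            Finset.univ.image fun j : Fin (N (c s)) => (c s, g ⟨s, j⟩) := by
          intro q hq
          obtain ⟨hqF, hqs⟩ := Finset.mem_filter.1 hq
          obtain ⟨⟨t, j⟩, -, rfl⟩ := Finset.mem_image.1 hqF
          obtain rfl : t = s := hc hqs
          exact Finset.mem_image.2 ⟨j, Finset.mem_univ j, rfl⟩
        refine (Finset.card_le_card hsub).trans (Finset.card_image_le.trans ?_)
        simp
      · rw [sliceCard, Finset.filter_false_of_mem]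
        · simp
        · intro q hq hqi
          obtain ⟨a, -, rfl⟩ := Finset.mem_image.1 hq
          exact hi ⟨a.1, hqi⟩
    refine ⟨g, hg, hgS, SigmaSpace.ofFinset F hFN, fun a => hA _ _ _ fun q hq => ?_⟩
    rw [Bool.eq_iff_iff, SigmaSpace.ofFinset_eq_true, SigmaSpace.ofFinset_eq_true,
      Finset.mem_singleton]
    constructor
    · intro hqF
      obtain ⟨b, -, rfl⟩ := Finset.mem_image.1 hqF
      by_cases hba : b = a
      · rw [hba]
      · exact absurd (Finset.mem_image.2 ⟨_, hq, rfl⟩) (hfree b a hba)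
    · rintro rfl
      exact Finset.mem_image.2 ⟨a, Finset.mem_univ a, rfl⟩

/-- Each of the families is obstructed by some coordinate `i`: there its intersection number `m s`
is the largest number `m` with `r + m * d ≤ N i`, where `r` and `d` are the sizes of the root and of
the petals of the supports in the coordinate `i`. Two families obstructed by the same coordinate
cannot both be packed into it. -/
theorem HasIntersectionFamilies.exists_injective [Countable I] [Uncountable Γ] (hn : 0 < n)
    (h : HasIntersectionFamilies Γ (∀ i, SigmaSpace (N i) Γ) n k) :
    ∃ c : Fin k → I, Function.Injective c ∧ ∀ s, n ≤ N (c s) := by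
  classical
  obtain ⟨m, p, U, hm, hU, hsep, hmeet⟩ := h
  choose A hA using fun s γ => SigmaSpace.exists_finset_of_mem_nhds (hU s γ)
  -- Thin out the index set so that the supports form a `Δ`-system with uniform sizes.
  obtain ⟨J, hJ⟩ := Set.exists_not_countable_fiber (Set.not_countable_univ (α := Γ))
    fun γ => Finset.univ.biUnion fun s => (A s γ).image Prod.fst
  let f : Fin k → Γ → Finset (I × Γ) := fun s γ => SigmaSpace.support J (p s γ)
  obtain ⟨S', hS'J, hS', R, hR⟩ :=
    Set.exists_deltaSystem (fun γ => Finset.univ.biUnion fun s => f s γ) hJ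
  obtain ⟨b, hb⟩ := Set.exists_not_countable_fiber
    (β := (Fin k → {T : Finset (I × Γ) // T ∈ R.powerset}) × (Fin k → J → ℕ)) hS'
    fun γ => (fun s => ⟨f s γ ∩ R, Finset.mem_powerset.2 Finset.inter_subset_right⟩,
      fun s i => sliceCard (f s γ \ R) i)
  set S : Set Γ := {γ ∈ S' | _} with hSdef
  let r : Fin k → Finset (I × Γ) := fun s => b.1 s
  let d : Fin k → I → ℕ := fun s i => if hi : i ∈ J then b.2 s ⟨i, hi⟩ else 0
  have hAJ : ∀ s, ∀ γ ∈ S, ∀ q ∈ A s γ, q.1 ∈ J := by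
    intro s γ hγ q hq
    rw [← (hS'J hγ.1).2]
    exact Finset.mem_biUnion.2 ⟨s, Finset.mem_univ s, Finset.mem_image_of_mem _ hq⟩
  have hr : ∀ s, ∀ γ ∈ S, f s γ ∩ R = r s := by
    intro s γ hγ
    exact congrArg Subtype.val (congrFun (congrArg Prod.fst hγ.2) s)
  have hd : ∀ s, ∀ γ ∈ S, ∀ i ∈ J, sliceCard (f s γ \ R) i = d s i := by
    intro s γ hγ i hi
    simp only [d, hi, dif_pos]
    exact congrFun (congrFun (congrArg Prod.snd hγ.2) s) ⟨i, hi⟩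
  have hsplit : ∀ s, ∀ γ ∈ S, f s γ = r s ∪ f s γ \ R := by
    intro s γ hγ
    rw [← hr s γ hγ, Finset.union_comm, Finset.sdiff_union_inter]
  have hdisj : ∀ s t, ∀ γ ∈ S, ∀ δ ∈ S, γ ≠ δ → Disjoint (f s γ \ R) (f t δ \ R) := by
    intro s t γ hγ δ hδ hne
    rw [Finset.disjoint_left]
    intro q hq hq'
    rw [Finset.mem_sdiff] at hq hq'
    refine hq.2 ?_
    rw [← hR γ hγ.1 δ hδ.1 hne]
    exact Finset.mem_inter.2 ⟨Finset.mem_biUnion.2 ⟨s, Finset.mem_univ s, hq.1⟩,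
      Finset.mem_biUnion.2 ⟨t, Finset.mem_univ t, hq'.1⟩⟩
  -- If no coordinate obstructed the family, `m s + 1` of the sets `U s γ` would meet.
  have hobs : ∀ s, ∃ i ∈ J, N i < sliceCard (r s) i + (m s + 1) * d s i := by
    intro s
    by_contra! hcon
    have hBfin : ∀ γ, {δ ∈ S | ¬ Disjoint (f s δ \ R) (A s γ)}.Finite := by
      intro γ
      refine ((A s γ).finite_toSet.biUnion (t := fun q => {δ ∈ S | q ∈ f s δ \ R})
        fun q _ => Set.Subsingleton.finite ?_).subset ?_
      · intro δ hδ δ' hδ'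
        by_contra hne
        exact Finset.disjoint_left.1 (hdisj s s δ hδ.1 δ' hδ'.1 hne) hδ.2 hδ'.2
      · rintro δ ⟨hδ, hnd⟩
        obtain ⟨q, hq, hqA⟩ := Finset.not_disjoint_iff.1 hnd
        exact Set.mem_biUnion hqA ⟨hδ, hq⟩
    obtain ⟨g, hg, hgS, hfree⟩ := Set.exists_injective_free (κ := Fin (m s + 1)) hb
      fun _ γ => (hBfin γ).toFinset
    let F : Finset (I × Γ) := Finset.univ.biUnion fun j => f s (g j)
    have hFN : ∀ i, sliceCard F i ≤ N i := by
      intro i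
      by_cases hi : i ∈ J
      · have hsub : F ⊆ r s ∪ Finset.univ.biUnion fun j => f s (g j) \ R := by
          intro q hq
          obtain ⟨j, -, hqj⟩ := Finset.mem_biUnion.1 hq
          rw [hsplit s _ (hgS j)] at hqj
          rcases Finset.mem_union.1 hqj with hqj | hqj
          · exact Finset.mem_union_left _ hqj
          · exact Finset.mem_union_right _ (Finset.mem_biUnion.2 ⟨j, Finset.mem_univ j, hqj⟩)
        refine (sliceCard_mono hsub i).trans ((sliceCard_union_le _ _ i).trans
          (le_trans ?_ (hcon i hi)))
        refine Nat.add_le_add_left ((sliceCard_biUnion_le _ _ i).trans ?_) _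
        rw [Finset.sum_congr rfl fun j _ => hd s (g j) (hgS j) i hi]
        simp
      · rw [sliceCard, Finset.filter_false_of_mem]
        · simp
        · rintro q hq rfl
          obtain ⟨j, -, hqj⟩ := Finset.mem_biUnion.1 hq
          exact hi (SigmaSpace.mem_support.1 hqj).1
    refine hsep s g hg ⟨SigmaSpace.ofFinset F hFN, fun j => hA _ _ _ fun q hq => ?_⟩
    have hmem : (p s (g j) q.1).1 q.2 = true ↔ q ∈ f s (g j) := by
      simp [f, SigmaSpace.mem_support, hAJ s _ (hgS j) q hq]
    rw [Bool.eq_iff_iff, SigmaSpace.ofFinset_eq_true, hmem]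
    refine ⟨fun hqF => ?_, fun hqf => Finset.mem_biUnion.2 ⟨j, Finset.mem_univ j, hqf⟩⟩
    obtain ⟨l, -, hql⟩ := Finset.mem_biUnion.1 hqF
    by_cases hqR : q ∈ R
    · have : q ∈ f s (g j) ∩ R := by
        rw [hr s _ (hgS j), ← hr s _ (hgS l)]
        exact Finset.mem_inter.2 ⟨hql, hqR⟩
      exact (Finset.mem_inter.1 this).1
    · by_cases hlj : l = j
      · exact hlj ▸ hql
      · refine absurd ((hBfin _).mem_toFinset.2 ⟨hgS l, Finset.not_disjoint_iff.2
          ⟨q, Finset.mem_sdiff.2 ⟨hql, hqR⟩, hq⟩⟩) (hfree l j hlj)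
  -- All the families can be packed simultaneously into each coordinate.
  have hpack : ∀ s, ∀ i ∈ J, sliceCard (r s) i + ∑ t, m t * d t i ≤ N i := by
    intro s i hi
    obtain ⟨g, hg, hgS, y, hy⟩ := hmeet S hb
      (fun t γ => {y | ∀ q ∈ f t γ, (y q.1).1 q.2 = (p t γ q.1).1 q.2})
      fun t γ => SigmaSpace.setOf_eq_mem_nhds _ _
    have hsub : ∀ a : Σ t, Fin (m t), f a.1 (g a) ⊆ SigmaSpace.support J y := by
      intro a q hq
      obtain ⟨hqJ, hqt⟩ := SigmaSpace.mem_support.1 hq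
      exact SigmaSpace.mem_support.2 ⟨hqJ, (hy a q hq).trans hqt⟩
    have hrsub : r s ⊆ SigmaSpace.support J y := by
      rw [← hr s _ (hgS ⟨s, ⟨0, hn.trans_le (hm s)⟩⟩)]
      exact Finset.inter_subset_left.trans (hsub ⟨s, ⟨0, hn.trans_le (hm s)⟩⟩)
    have hrR : r s ⊆ R := by
      rw [← hr s _ (hgS ⟨s, ⟨0, hn.trans_le (hm s)⟩⟩)]
      exact Finset.inter_subset_right
    have hunion : r s ∪ (Finset.univ.biUnion fun a => f a.1 (g a) \ R) ⊆
        SigmaSpace.support J y :=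
      Finset.union_subset hrsub (Finset.biUnion_subset.2 fun a _ =>
        Finset.sdiff_subset.trans (hsub a))
    have hle := (sliceCard_mono hunion i).trans (SigmaSpace.sliceCard_support_le J y i)
    rw [sliceCard_union_of_disjoint, sliceCard_biUnion,
      Finset.sum_congr rfl fun a _ => hd a.1 (g a) (hgS a) i hi, Fintype.sum_sigma] at hle
    · simpa using hle
    · exact fun a _ b _ hab => hdisj _ _ _ (hgS a) _ (hgS b) (hg.ne hab)
    · rw [Finset.disjoint_biUnion_right]
      exact fun a _ => Finset.disjoint_of_subset_left hrR Finset.disjoint_sdiff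
  choose c hcJ hc using hobs
  refine ⟨c, fun s t hst => ?_, fun s => ?_⟩
  · by_contra hne
    have hs := hc s
    have ht := hc t
    have hps := hpack s (c s) (hcJ s)
    have hpt := hpack t (c t) (hcJ t)
    rw [← hst] at ht hpt
    have hpair : m s * d s (c s) + m t * d t (c s) ≤ ∑ u, m u * d u (c s) := by
      rw [← Finset.sum_pair hne (f := fun u => m u * d u (c s))]
      exact Finset.sum_le_sum_of_subset (Finset.subset_univ _)
    have h1 : d s (c s) ≤ m s * d s (c s) := Nat.le_mul_of_pos_left _ (hn.trans_le (hm s))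
    have h2 : d t (c s) ≤ m t * d t (c s) := Nat.le_mul_of_pos_left _ (hn.trans_le (hm t))
    rw [Nat.add_mul, one_mul] at hs ht
    omega
  · have hs := hc s
    have hps := hpack s (c s) (hcJ s)
    have hone : m s * d s (c s) ≤ ∑ u, m u * d u (c s) :=
      Finset.single_le_sum (f := fun u => m u * d u (c s)) (fun _ _ => Nat.zero_le _)
        (Finset.mem_univ s)
    rw [Nat.add_mul, one_mul] at hs
    have hpos : 0 < d s (c s) := by omega
    have := Nat.le_mul_of_pos_right (m s) hpos
    have := hm s
    omega

end Invariant

/-! ### Counting the factors of a product -/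

section Counting

theorem Set.natCast_le_encard_iff {α : Type*} {S : Set α} {k : ℕ} :
    (k : ℕ∞) ≤ S.encard ↔ ∃ c : Fin k → α, Function.Injective c ∧ ∀ s, c s ∈ S := by
  constructor
  · intro h
    obtain ⟨t, htS, ht⟩ := exists_subset_encard_eq h
    have hfin : t.Finite := finite_of_encard_eq_coe ht
    rw [hfin.encard_eq_coe_toFinset_card, Nat.cast_inj] at ht
    let e := (hfin.toFinset.equivFinOfCardEq ht).symm
    exact ⟨fun s => e s, Subtype.val_injective.comp e.injective,
      fun s => htS (hfin.mem_toFinset.1 (e s).2)⟩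
  · rintro ⟨c, hc, hcS⟩
    calc (k : ℕ∞) = (range c).encard := by
          rw [← image_univ, hc.encard_image, encard_univ, ENat.card_eq_coe_fintype_card,
            Fintype.card_fin]
      _ ≤ S.encard := encard_le_encard (range_subset_iff.2 hcS)

theorem ENat.card_subtype_natCast_lt (t : ℕ∞) : ENat.card {k : ℕ // (k : ℕ∞) < t} = t := by
  cases t with
  | top =>
    rw [ENat.card_congr (Equiv.subtypeUnivEquiv fun k => ENat.natCast_lt_top k)]
    simp
  | coe t =>
    rw [ENat.card_congr ((Equiv.subtypeEquivRight fun k => Nat.cast_lt).trans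
      Fin.equivSubtype.symm), ENat.card_eq_coe_fintype_card, Fintype.card_fin]

/-- The number, possibly `⊤`, of factors `σ_i(Γ)` with `i ≥ n` in the product `σ_τ(Γ)`. -/
noncomputable def factorCount (τ : ℕ+ → ℕ∞) (n : ℕ+) : ℕ∞ :=
  {i : Σ m : ℕ+, {k : ℕ // (k : ℕ∞) < τ m} | n ≤ i.1}.encard

/-- The factor counts are determined by the topology of the product. -/
theorem natCast_le_factorCount_iff {Γ : Type*} [Uncountable Γ] {τ : ℕ+ → ℕ∞} {n : ℕ+} {k : ℕ} :
    (k : ℕ∞) ≤ factorCount τ n ↔ HasIntersectionFamilies Γ (SigmaProd τ Γ) n k := by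
  let e : SigmaProd τ Γ ≃ₜ _ := Homeomorph.piSigma _ fun m : ℕ+ => SigmaSpace (m : ℕ) Γ
  rw [factorCount, Set.natCast_le_encard_iff]
  constructor
  · rintro ⟨c, hc, hcn⟩
    exact (HasIntersectionFamilies.of_injective (N := fun i => (i.1 : ℕ)) n.pos c hc
      hcn).of_homeomorph e.symm
  · exact fun h => (h.of_homeomorph e).exists_injective n.pos

theorem factorCount_congr {Γ : Type*} [Uncountable Γ] {τ τ' : ℕ+ → ℕ∞}
    (e : SigmaProd τ' Γ ≃ₜ SigmaProd τ Γ) (n : ℕ+) : factorCount τ n = factorCount τ' n :=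
  ENat.eq_of_forall_natCast_le_iff fun _ => by
    rw [natCast_le_factorCount_iff (Γ := Γ), natCast_le_factorCount_iff (Γ := Γ)]
    exact ⟨fun h => h.of_homeomorph e.symm, fun h => h.of_homeomorph e⟩

theorem encard_range_sigmaMk (τ : ℕ+ → ℕ∞) (n : ℕ+) :
    (Set.range fun k => (⟨n, k⟩ : Σ m : ℕ+, {k : ℕ // (k : ℕ∞) < τ m})).encard = τ n := by
  rw [← Set.image_univ]
  refine (sigma_mk_injective.encard_image _).trans ?_
  rw [Set.encard_univ, ENat.card_subtype_natCast_lt]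

theorem factorCount_eq_add (τ : ℕ+ → ℕ∞) (n : ℕ+) :
    factorCount τ n = τ n + factorCount τ (n + 1) := by
  rw [← encard_range_sigmaMk τ n, factorCount, factorCount, ← Set.encard_union_eq]
  · refine congrArg Set.encard (Set.ext ?_)
    rintro ⟨m, k⟩
    simp only [Set.mem_ofPred_eq, Set.mem_union, Set.mem_range, PNat.add_one_le_iff]
    constructor
    · intro h
      rcases h.eq_or_lt with rfl | h
      · exact Or.inl ⟨k, rfl⟩
      · exact Or.inr h
    · rintro (⟨k', h⟩ | h)
      · exact (congrArg Sigma.fst h).le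
      · exact h.le
  · rw [Set.disjoint_left]
    rintro _ ⟨k, rfl⟩ h
    exact (PNat.add_one_le_iff.1 h).false

theorem le_factorCount {τ : ℕ+ → ℕ∞} {n m : ℕ+} (h : n ≤ m) : τ m ≤ factorCount τ n := by
  rw [← encard_range_sigmaMk τ m]
  refine Set.encard_le_encard ?_
  rintro _ ⟨k, rfl⟩
  exact h

/-- If only finitely many exponents are nonzero, infinitely many factors of size at least `n` can
only come from an infinite exponent. -/
theorem exists_eq_top_of_factorCount {τ : ℕ+ → ℕ∞} {N n : ℕ+} (hN : ∀ m, N < m → τ m = 0)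
    (h : factorCount τ n = ⊤) : ∃ m, n ≤ m ∧ τ m = ⊤ := by
  by_contra! hcon
  have hfin : (⋃ m ∈ Set.Icc n N, Set.range fun k =>
      (⟨m, k⟩ : Σ m : ℕ+, {k : ℕ // (k : ℕ∞) < τ m})).Finite := by
    refine (Set.finite_Icc n N).biUnion fun m hm => Set.encard_ne_top_iff.1 ?_
    rw [encard_range_sigmaMk]
    exact hcon m hm.1
  refine Set.encard_ne_top_iff.2 (hfin.subset ?_) h
  rintro ⟨m, k, hk⟩ hm
  refine Set.mem_biUnion (x := m) ⟨hm, ?_⟩ ⟨⟨k, hk⟩, rfl⟩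
  by_contra! hlt
  simp [hN m hlt] at hk

/-- A finite value of `supI τ` is attained; the value `0` corresponds to the absence of infinite
exponents and is below every `n : ℕ+`. -/
theorem natCast_le_supI_iff {τ : ℕ+ → ℕ∞} {n : ℕ+} :
    ((n : ℕ) : ℕ∞) ≤ supI τ ↔ ∃ m, n ≤ m ∧ τ m = ⊤ := by
  constructor
  · intro h
    by_contra! hcon
    have hle : supI τ ≤ ((n - 1 : ℕ) : ℕ∞) := by
      refine iSup₂_le fun m hm => ?_
      have hmn : (m : ℕ) < n := not_le.1 fun h => hcon m h hm
      exact_mod_cast Nat.le_sub_one_of_lt hmn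
    have h' : (n : ℕ) ≤ n - 1 := by exact_mod_cast h.trans hle
    have := n.pos
    omega
  · rintro ⟨m, hnm, hm⟩
    refine le_trans ?_ (le_iSup₂ (f := fun (n : ℕ+) (_ : τ n = ⊤) => ((n : ℕ) : ℕ∞)) m hm)
    exact_mod_cast hnm

theorem supI_le_of_factorCount_eq {τ τ' : ℕ+ → ℕ∞} {N : ℕ+} (hN : ∀ m, N < m → τ' m = 0)
    (h : ∀ n, factorCount τ n = factorCount τ' n) : supI τ ≤ supI τ' :=
  iSup₂_le fun m hm => natCast_le_supI_iff.2 (exists_eq_top_of_factorCount hN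
    (top_le_iff.1 (hm ▸ (le_factorCount le_rfl).trans_eq (h m))))

end Counting

theorem theorem1 {Γ : Type*} [Uncountable Γ] (τ τ' : ℕ+ → ℕ∞) :
    (supJ τ < ⊤ →
      (Nonempty (SigmaProd τ' Γ ≃ₜ SigmaProd τ Γ) ↔
        supI τ = supI τ' ∧ ∀ n : ℕ+, supI τ < ((n : ℕ) : ℕ∞) → τ n = τ' n)) ∧
    (supI τ = ⊤ → supI τ' = ⊤ → Nonempty (SigmaProd τ Γ ≃ₜ SigmaProd τ' Γ)) := by
  have of_eq : supI τ = supI τ' → (∀ n : ℕ+, supI τ < ((n : ℕ) : ℕ∞) → τ n = τ' n) →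
      Nonempty (SigmaProd τ Γ ≃ₜ SigmaProd τ' Γ) := by
    intro hI htail
    refine SigmaProd.nonempty_homeomorph (fun n => ?_) fun n hn => htail n ?_
    · rw [← natCast_le_supI_iff, ← natCast_le_supI_iff, hI]
    · exact not_le.1 fun h => hn (natCast_le_supI_iff.1 h)
  refine ⟨fun hJ => ⟨?_, fun ⟨hI, htail⟩ => (of_eq hI htail).map Homeomorph.symm⟩,
    fun h h' => of_eq (h.trans h'.symm) (by simp [h])⟩
  rintro ⟨e⟩
  have hcount := factorCount_congr e
  obtain ⟨N, hN⟩ : ∃ N : ℕ+, ∀ m, N < m → τ m = 0 := by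
    refine ⟨⟨(supJ τ).toNat + 1, Nat.succ_pos _⟩, fun m hm => ?_⟩
    by_contra hne
    have hle : ((m : ℕ) : ℕ∞) ≤ supJ τ :=
      le_iSup₂ (f := fun (n : ℕ+) (_ : 0 < τ n) => ((n : ℕ) : ℕ∞)) m (pos_iff_ne_zero.2 hne)
    rw [← ENat.natCast_toNat hJ.ne, Nat.cast_le] at hle
    have hm' : (supJ τ).toNat + 1 < (m : ℕ) := hm
    omega
  have hN' : ∀ m, N < m → τ' m = 0 := by
    intro m hm
    have h0 : factorCount τ m = 0 := by
      rw [factorCount, Set.encard_eq_zero, Set.eq_empty_iff_forall_notMem]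
      rintro ⟨l, k, hk⟩ hl
      simp [hN l (hm.trans_le hl)] at hk
    exact nonpos_iff_eq_zero.1 ((le_factorCount le_rfl).trans_eq ((hcount m).symm.trans h0))
  refine ⟨le_antisymm (supI_le_of_factorCount_eq hN' hcount)
    (supI_le_of_factorCount_eq hN fun n => (hcount n).symm), fun n hn => ?_⟩
  have hfin : factorCount τ (n + 1) ≠ ⊤ := fun h => by
    obtain ⟨m, hm, hm'⟩ := exists_eq_top_of_factorCount hN h
    exact hn.not_ge (natCast_le_supI_iff.2 ⟨m, (PNat.lt_add_right n 1).le.trans hm, hm'⟩)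
  have h := hcount n
  rw [factorCount_eq_add, factorCount_eq_add τ', ← hcount (n + 1)] at h
  exact WithTop.add_right_cancel hfin h
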